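/- For $n\in\mathbb{N}$ let $t_n\in\{0,1\}$ be the parity of the sum of the binary digits of $n$ (the Prouhet--Thue--Morse sequence), and let $F(X)=\sum_{n\ge 0}t_nX^n\in\mathbb{F}_2[[X]]$. Since $t_0=0$ and $t_1=1$, the series $F$ has a unique compositional inverse $G(X)=\sum_{n\ge 0}c_nX^n\in\mathbb{F}_2[[X]]$, that is, $G(0)=0$ and $F(G(X))=G(F(X))=X$. Regard each coefficient $c_n\in\{0,1\}$ as a complex number and put $C(X)=\sum_{n\ge 0}c_nX^n\in\mathbb{C}[[X]]$. Then $$C(X)=X(X+1)+\frac{X^3(X^4-1)}{(X-1)(X^4+1)}\,C(X^4)$$ in $\mathbb{C}[[X]]$ (where $(X-1)(X^4+1)$ is invertible). Moreover, $C(X)$ is transcendental over the field $\mathbb{C}(X)$ of rational functions. -/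

import Mathlib

open PowerSeries
open scoped RatFunc

noncomputable section

namespace IPTM

/-- The Prouhet-Thue-Morse sequence on `{0, 1}`: the parity of the sum of the binary digits. -/
def ptm (n : ℕ) : ℕ := (Nat.digits 2 n).sum % 2

/-- The generating series of the Prouhet-Thue-Morse sequence over the field with two elements. -/
def F : PowerSeries (ZMod 2) := PowerSeries.mk fun n => (ptm n : ZMod 2)

theorem constantCoeff_F : F.constantCoeff = 0 := by
  simp [F, ptm]

theorem coeff_one_F : F.coeff 1 = 1 := by
  simp [F, ptm]

theorem isUnit_coeff_one_F : IsUnit (F.coeff 1) := by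
  rw [coeff_one_F]; exact isUnit_one

/-- The compositional inverse of `F`. -/
def G : PowerSeries (ZMod 2) := F.substInvOfIsUnit isUnit_coeff_one_F

theorem constantCoeff_G : G.constantCoeff = 0 :=
  F.constantCoeff_substInvOfIsUnit isUnit_coeff_one_F

/-- `F(G(X)) = X`. -/
theorem F_comp_G : F.subst G = X :=
  F.subst_substInvOfIsUnit_right constantCoeff_F isUnit_coeff_one_F

/-- `G(F(X)) = X`. -/
theorem G_comp_F : G.subst F = X :=
  F.subst_substInvOfIsUnit_left constantCoeff_F isUnit_coeff_one_F

/-- The inverse Prouhet-Thue-Morse sequence, as a sequence of natural numbers in `{0, 1}`: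
`c n` is the representative in `{0, 1}` of the `n`-th coefficient of `G`. -/
def c (n : ℕ) : ℕ := (G.coeff n).val

/-- The generating series of `c` with complex coefficients. -/
def C : PowerSeries ℂ := PowerSeries.mk fun n => (c n : ℂ)

end IPTM

end

/-! The recursion for `ptm` makes `F` a root of a quadratic over `𝔽₂(X)`. Substituting `G` gives a
cubic for `G`, and hence a quartic involving only `G` and `G ^ 4`. Its only power series root is `(1
+ X)(K - 1) / X`, where `K = ∏ (1 + X ^ (2 * 4 ^ k))` is `moserSeries`. The integer coefficients of
this expression are already 0 or 1, so the formula lifts to `ℂ`, and `K = (1 + X ^ 2) K(X ^ 4)`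
yields the equation for `C`. For transcendence, that relation turns a minimal annihilator of `K`
into a proportional one. The ratio `r` of its leading to its constant coefficient then satisfies
`r(X ^ 4) = (1 + X ^ 2) ^ d * r(X)` with `d > 0`, which no nonzero rational function does. -/

namespace IPTM

/-! ### Transcendence of solutions of `K = (1 + X ^ 2) K(X ^ 4)` -/

open Polynomial in
theorem not_expand_four_eq_pow_mul {d : ℕ} (hd : 0 < d) {Q : ℂ[X]} (hQ : Q ≠ 0) :
    expand ℂ 4 Q ≠ (1 + Polynomial.X ^ 2) ^ d * Q := by
  intro h
  have hnat : (1 + Polynomial.X ^ 2 : ℂ[X]).natDegree = 2 := by compute_degree!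
  have hne : (1 + Polynomial.X ^ 2 : ℂ[X]) ≠ 0 := fun h0 => by simp [h0] at hnat
  have hdeg := congrArg natDegree h
  rw [natDegree_expand, natDegree_mul (pow_ne_zero _ hne) hQ, natDegree_pow, hnat] at hdeg
  -- `X ↦ iX` fixes `X ^ 4` and sends `1 + X ^ 2` to `1 - X ^ 2`. By coprimality `(1 - X ^ 2) ^ d ∣
  -- Q`, so `deg Q ≥ 2d`, against `3 deg Q = 2d` from `hdeg`.
  have hI : expand ℂ 4 Q = (1 - Polynomial.X ^ 2) ^ d * Q.comp (Polynomial.C Complex.I * Polynomial.X) := by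
    have h2 := congrArg (fun P : ℂ[X] => P.comp (Polynomial.C Complex.I * Polynomial.X)) h
    have h4 : (Polynomial.C Complex.I * Polynomial.X : ℂ[X]) ^ 4 = Polynomial.X ^ 4 := by
      rw [mul_pow, ← C_pow, Complex.I_pow_four, C_1, one_mul]
    have h3 : (Polynomial.C Complex.I * Polynomial.X : ℂ[X]) ^ 2 = -Polynomial.X ^ 2 := by
      rw [mul_pow, ← C_pow, Complex.I_sq, C_neg, C_1, neg_one_mul]
    simp only [expand_eq_comp_X_pow, comp_assoc, mul_comp, pow_comp, add_comp, X_comp,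
      one_comp, h4, h3] at h2
    rw [expand_eq_comp_X_pow, h2, sub_eq_add_neg]
  have hco : IsCoprime (1 - Polynomial.X ^ 2 : ℂ[X]) (1 + Polynomial.X ^ 2) :=
    ⟨Polynomial.C (1 / 2), Polynomial.C (1 / 2), by
      have : (Polynomial.C (1 / 2 : ℂ) : ℂ[X]) * 2 = 1 := by
        rw [← C_ofNat, ← C_mul]; norm_num
      linear_combination this⟩
  have hdvd : (1 - Polynomial.X ^ 2 : ℂ[X]) ^ d ∣ Q :=
    (hco.pow (m := d) (n := d)).dvd_of_dvd_mul_left ⟨_, h.symm.trans hI⟩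
  have hnat' : (1 - Polynomial.X ^ 2 : ℂ[X]).natDegree = 2 := by compute_degree!
  have := natDegree_le_of_dvd hdvd hQ
  rw [natDegree_pow, hnat'] at this
  omega

-- With `Q / P` in lowest terms, the expanded denominator divides the denominator, which is
-- therefore constant; this leaves the polynomial case.
open Polynomial in
theorem not_mul_expand_four_eq {d : ℕ} (hd : 0 < d) {P Q : ℂ[X]} (hP : P ≠ 0) (hQ : Q ≠ 0) :
    P * expand ℂ 4 Q ≠ (1 + Polynomial.X ^ 2) ^ d * expand ℂ 4 P * Q := by
  intro h
  obtain ⟨P', Q', hco, hP', hQ'⟩ : ∃ P' Q' : ℂ[X], IsCoprime P' Q' ∧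
      P = gcd P Q * P' ∧ Q = gcd P Q * Q' := by
    obtain ⟨P', Q', h1, h2, hu⟩ := extract_gcd P Q
    exact ⟨P', Q', (gcd_isUnit_iff _ _).1 hu, h1, h2⟩
  generalize gcd P Q = g at hP' hQ'
  have hg : g ≠ 0 := by rintro rfl; simp at hP'; exact hP hP'
  subst hP' hQ'
  have hge : expand ℂ 4 g ≠ 0 := (expand_ne_zero (by norm_num)).2 hg
  have h' : P' * expand ℂ 4 Q' = (1 + Polynomial.X ^ 2) ^ d * expand ℂ 4 P' * Q' := by
    apply mul_left_cancel₀ (mul_ne_zero hg hge)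
    simp only [map_mul] at h
    linear_combination h
  have hcoe : IsCoprime (expand ℂ 4 P') (expand ℂ 4 Q') := (isCoprime_expand (by norm_num)).2 hco
  have hdvd : expand ℂ 4 P' ∣ P' := hcoe.dvd_of_dvd_mul_right ⟨(1 + Polynomial.X ^ 2) ^ d * Q', by
    rw [h']; ring⟩
  have hdeg := natDegree_le_of_dvd hdvd (right_ne_zero_of_mul hP)
  rw [natDegree_expand] at hdeg
  obtain ⟨a, rfl⟩ : ∃ a, P' = Polynomial.C a := ⟨_, eq_C_of_natDegree_eq_zero (by omega)⟩
  refine not_expand_four_eq_pow_mul hd (right_ne_zero_of_mul hQ) ?_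
  apply mul_left_cancel₀ (right_ne_zero_of_mul hP)
  rw [h', Polynomial.expand_C]
  ring

theorem expand_coe (p : Polynomial ℂ) (n : ℕ) (hn : n ≠ 0) :
    PowerSeries.expand n hn (p : PowerSeries ℂ) = (Polynomial.expand ℂ n p : Polynomial ℂ) := by
  ext m
  rw [PowerSeries.coeff_expand, Polynomial.coeff_coe, Polynomial.coeff_coe,
    Polynomial.coeff_expand (Nat.pos_of_ne_zero hn)]

theorem algebraMap_polynomial_eq_coe (p : Polynomial ℂ) :
    algebraMap (Polynomial ℂ) ℂ⟦X⟧ p = p := by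
  rw [PowerSeries.algebraMap_apply']
  simp

theorem transcendental_of_eq_mul_expand_four {K : ℂ⟦X⟧} (hK0 : K ≠ 0)
    (hK : K = (1 + X ^ 2) * expand 4 four_ne_zero K) : Transcendental (Polynomial ℂ) K := by
  intro halg
  obtain ⟨p, ⟨hp0, hpK⟩, hmin⟩ := WellFounded.has_min (measure Polynomial.natDegree).wf
    {p : Polynomial (Polynomial ℂ) | p ≠ 0 ∧ Polynomial.aeval K p = 0} halg
  have hmin' : ∀ q : Polynomial (Polynomial ℂ), Polynomial.aeval K q = 0 →
      q.natDegree < p.natDegree → q = 0 := fun q hq hlt => by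
    by_contra hne
    exact hmin q ⟨hne, hq⟩ hlt
  have hd : 0 < p.natDegree := by
    by_contra hd
    obtain ⟨a, rfl⟩ : ∃ a, p = Polynomial.C a :=
      ⟨_, Polynomial.eq_C_of_natDegree_eq_zero (by omega)⟩
    rw [Polynomial.aeval_C, algebraMap_polynomial_eq_coe, Polynomial.coe_eq_zero_iff] at hpK
    simp [hpK] at hp0
  have hc0 : p.coeff 0 ≠ 0 := by
    intro h0
    have hX := Polynomial.X_mul_divX_add p
    rw [h0, Polynomial.C_0, add_zero] at hX
    have hz : p.divX = 0 := by
      refine hmin' _ ?_ ?_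
      · have := congrArg (Polynomial.aeval K) hX
        rw [hpK, map_mul, Polynomial.aeval_X] at this
        exact (mul_eq_zero.1 this).resolve_left hK0
      · rw [Polynomial.natDegree_divX_eq_natDegree_tsub_one]; omega
    rw [hz, mul_zero] at hX
    exact hp0 hX.symm
  have hinj : Function.Injective (Polynomial.expand ℂ 4) :=
    Polynomial.expand_injective (by norm_num)
  -- Expanding the coefficients gives an annihilator of `K(X ^ 4)`; scaling its roots by `1 + X ^ 2`
  -- gives one of `K`, of the same degree.
  let q := (p.map (Polynomial.expand ℂ 4).toRingHom).scaleRoots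
    (1 + Polynomial.X ^ 2)
  have hqdeg : q.natDegree = p.natDegree := by
    rw [Polynomial.natDegree_scaleRoots, Polynomial.natDegree_map_eq_of_injective hinj]
  have hqK : Polynomial.aeval K q = 0 := by
    have h1 : Polynomial.aeval (expand 4 four_ne_zero K)
        (p.map (Polynomial.expand ℂ 4).toRingHom) = 0 := by
      have h2 := congrArg (expand 4 four_ne_zero : ℂ⟦X⟧ →ₐ[ℂ] ℂ⟦X⟧).toRingHom hpK
      rw [Polynomial.aeval_def, Polynomial.hom_eval₂, map_zero] at h2
      rw [Polynomial.aeval_def, Polynomial.eval₂_map, ← h2]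
      congr 1
      refine RingHom.ext fun a => ?_
      change algebraMap _ ℂ⟦X⟧ (Polynomial.expand ℂ 4 a) =
        expand 4 four_ne_zero (algebraMap _ ℂ⟦X⟧ a)
      rw [algebraMap_polynomial_eq_coe, algebraMap_polynomial_eq_coe, expand_coe]
    have h3 := Polynomial.scaleRoots_aeval_eq_zero (r := 1 + Polynomial.X ^ 2) h1
    rw [algebraMap_polynomial_eq_coe] at h3
    rwa [Polynomial.coe_add, Polynomial.coe_one, Polynomial.coe_pow, Polynomial.coe_X, ← hK] at h3
  have hq (i : ℕ) : q.coeff i =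
      Polynomial.expand ℂ 4 (p.coeff i) * (1 + Polynomial.X ^ 2) ^ (p.natDegree - i) := by
    rw [Polynomial.coeff_scaleRoots, Polynomial.natDegree_map_eq_of_injective hinj,
      Polynomial.coeff_map]
    rfl
  have hzero : Polynomial.C p.leadingCoeff * q - Polynomial.C q.leadingCoeff * p = 0 := by
    refine hmin' _ (by simp [hqK, hpK]) ?_
    have := Polynomial.natDegree_cancelLeads_lt_of_natDegree_le_natDegree hqdeg.ge (hqdeg ▸ hd)
    rwa [Polynomial.cancelLeads, hqdeg, Nat.sub_self, pow_zero, mul_one, mul_one] at this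
  have h0 := congrArg (fun r => Polynomial.coeff r 0) hzero
  simp only [Polynomial.coeff_sub, Polynomial.coeff_C_mul, Polynomial.coeff_zero] at h0
  rw [Polynomial.leadingCoeff, Polynomial.leadingCoeff, hqdeg, hq, hq] at h0
  refine not_mul_expand_four_eq hd hc0 (Polynomial.leadingCoeff_ne_zero.2 hp0) ?_
  simp only [Nat.sub_self, pow_zero, mul_one, Nat.sub_zero] at h0
  rw [Polynomial.leadingCoeff]
  linear_combination -h0

/-! ### The explicit series -/

/-- The indicator function of the natural numbers whose base 4 digits all lie in `{0, 2}`. -/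
def moser (n : ℕ) : ℕ := if ∀ d ∈ Nat.digits 4 n, d = 0 ∨ d = 2 then 1 else 0

theorem moser_zero : moser 0 = 1 := by simp [moser]

theorem moser_add_four_mul {d : ℕ} (hd : d < 4) (m : ℕ) :
    moser (d + 4 * m) = if d = 0 ∨ d = 2 then moser m else 0 := by
  by_cases h : d ≠ 0 ∨ m ≠ 0
  · rw [moser, Nat.digits_add 4 (by norm_num) d m hd h]
    by_cases h2 : d = 0 ∨ d = 2 <;> simp [h2, moser]
  · obtain ⟨rfl, rfl⟩ : d = 0 ∧ m = 0 := by simpa using h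
    simp

theorem moser_odd (m : ℕ) : moser (2 * m + 1) = 0 := by
  have h := moser_add_four_mul (d := 1 + 2 * (m % 2)) (by omega) (m / 2)
  rw [if_neg (by omega)] at h
  rw [← h]
  congr 1
  omega

theorem moser_le_one (n : ℕ) : moser n ≤ 1 := by
  unfold moser; split_ifs <;> simp

variable (R : Type*) [CommRing R]

/-- The generating series of `moser`. -/
noncomputable def moserSeries : R⟦X⟧ := PowerSeries.mk fun n => (moser n : R)

theorem moserSeries_eq :
    moserSeries R = (1 + X ^ 2) * expand 4 four_ne_zero (moserSeries R) := by
  ext n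
  have hn : n = n % 4 + 4 * (n / 4) := by omega
  have hlt : n % 4 < 4 := Nat.mod_lt _ (by norm_num)
  generalize n % 4 = d at hn hlt
  generalize n / 4 = m at hn
  subst hn
  rw [add_mul, one_mul, map_add, coeff_X_pow_mul', coeff_expand, coeff_expand]
  simp only [moserSeries, coeff_mk, moser_add_four_mul hlt]
  interval_cases d
  · have : ¬ (2 ≤ 0 + 4 * m ∧ 4 ∣ 0 + 4 * m - 2) := by omega
    simp only [← ite_and, if_neg this]
    simp
  · have : ¬ (2 ≤ 1 + 4 * m ∧ 4 ∣ 1 + 4 * m - 2) := by omega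
    have h2 : ¬ 4 ∣ 1 + 4 * m := by omega
    simp only [← ite_and, if_neg this, if_neg h2]
    simp
  · have h2 : ¬ 4 ∣ 2 + 4 * m := by omega
    simp [h2]
  · have : ¬ (2 ≤ 3 + 4 * m ∧ 4 ∣ 3 + 4 * m - 2) := by omega
    have h2 : ¬ 4 ∣ 3 + 4 * m := by omega
    simp only [← ite_and, if_neg this, if_neg h2]
    simp

/-- An explicit form of the inverse Prouhet-Thue-Morse sequence. -/
def explicitCoeff (n : ℕ) : ℕ := if n = 0 then 0 else moser (n + 1) + moser n

/-- One of `n`, `n + 1` is odd, where `moser` vanishes. Hence reduction mod 2 loses nothing. -/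
theorem explicitCoeff_le_one (n : ℕ) : explicitCoeff n ≤ 1 := by
  unfold explicitCoeff
  split_ifs
  · simp
  · obtain ⟨k, rfl | rfl⟩ := n.even_or_odd'
    · rw [moser_odd, zero_add]; exact moser_le_one _
    · rw [moser_odd, add_zero]; exact moser_le_one _

/-- The generating series of `explicitCoeff`. -/
noncomputable def explicitSeries : R⟦X⟧ := PowerSeries.mk fun n => (explicitCoeff n : R)

theorem X_mul_explicitSeries :
    X * explicitSeries R = (1 + X) * (moserSeries R - 1) := by
  ext n
  rw [add_mul, one_mul, map_add]
  have h1 : moser 1 = 0 := moser_odd 0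
  rcases n with _ | _ | n
  · simp [moserSeries, moser_zero]
  · simp [moserSeries, explicitSeries, explicitCoeff, moser_zero, h1, coeff_succ_X_mul,
      PowerSeries.coeff_one]
  · simp [moserSeries, explicitSeries, explicitCoeff, coeff_succ_X_mul, PowerSeries.coeff_one]

/-! ### Algebraic equations over `𝔽₂` and identification of `G` -/

theorem expand_two_eq_sq (f : (ZMod 2)⟦X⟧) : expand 2 two_ne_zero f = f ^ 2 := by
  have h := MvPowerSeries.map_frobenius_expand 2 two_ne_zero (f := f)
  rwa [ZMod.frobenius_zmod, MvPowerSeries.map_id] at h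

theorem expand_four_eq_pow (f : (ZMod 2)⟦X⟧) : expand 4 four_ne_zero f = f ^ 4 := by
  have h := PowerSeries.expand_mul 2 two_ne_zero 2 two_ne_zero f
  rw [expand_two_eq_sq, expand_two_eq_sq, ← pow_mul] at h
  exact h

theorem ptm_two_mul (m : ℕ) : ptm (2 * m) = ptm m := by
  rcases Nat.eq_zero_or_pos m with rfl | h
  · rfl
  · have := Nat.digits_add 2 (by norm_num) 0 m (by norm_num) (Or.inr h.ne')
    rw [zero_add] at this
    simp [ptm, this]

theorem ptm_two_mul_add_one (m : ℕ) : (ptm (2 * m + 1) : ZMod 2) = 1 + ptm m := by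
  have := Nat.digits_add 2 (by norm_num) 1 m (by norm_num) (Or.inl one_ne_zero)
  rw [add_comm] at this
  simp only [ptm, this, List.sum_cons, ZMod.natCast_mod, Nat.cast_add, Nat.cast_one]

theorem two_eq_zero : (2 : (ZMod 2)⟦X⟧) = 0 := by
  rw [← map_ofNat (PowerSeries.C (R := ZMod 2)) 2,
    show (OfNat.ofNat 2 : ZMod 2) = 0 from rfl, map_zero]

theorem F_eq : F = (1 + X) * F ^ 2 + X * expand 2 two_ne_zero (PowerSeries.mk 1) := by
  ext n
  rw [← expand_two_eq_sq, add_mul, one_mul, map_add, map_add]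
  obtain ⟨k, rfl | rfl⟩ := n.even_or_odd'
  · rcases k with _ | k
    · simp [F]
    · rw [show 2 * (k + 1) = (2 * k + 1) + 1 by ring, coeff_succ_X_mul, coeff_succ_X_mul,
        coeff_expand_of_not_dvd 2 _ _ (by omega : ¬ 2 ∣ 2 * k + 1),
        coeff_expand_of_not_dvd 2 _ _ (by omega : ¬ 2 ∣ 2 * k + 1),
        show (2 * k + 1) + 1 = 2 * (k + 1) by ring, coeff_expand_mul]
      simp [F, ptm_two_mul]
  · rw [coeff_succ_X_mul, coeff_succ_X_mul, coeff_expand_mul, coeff_expand_mul,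
        coeff_expand_of_not_dvd 2 _ _ (by omega : ¬ 2 ∣ 2 * k + 1)]
    simp [F, ptm_two_mul_add_one, add_comm (1 : ZMod 2)]

theorem F_cubic : (1 + X) ^ 2 * F = (1 + X) ^ 3 * F ^ 2 + X := by
  have hg : (1 + X) ^ 2 * expand 2 two_ne_zero (PowerSeries.mk 1 : (ZMod 2)⟦X⟧) = 1 := by
    rw [expand_two_eq_sq, ← mul_pow]
    have := PowerSeries.mk_one_mul_one_sub_eq_one (ZMod 2)
    rw [show (1 + X) * PowerSeries.mk 1 = (1 : (ZMod 2)⟦X⟧) by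
      linear_combination this + X * PowerSeries.mk 1 * two_eq_zero, one_pow]
  linear_combination (1 + X) ^ 2 * F_eq + X * hg

theorem G_cubic : (1 + G) ^ 2 * X = (1 + G) ^ 3 * X ^ 2 + G := by
  have hs : HasSubst G := HasSubst.of_constantCoeff_zero' constantCoeff_G
  have h := congrArg (substAlgHom hs) F_cubic
  simp only [map_add, map_mul, map_pow, map_one, substAlgHom_X, coe_substAlgHom, F_comp_G] at h
  exact h

/-- The multiplier `X * (1 + G) + 1` cancels, in characteristic 2, the square and cube of `1 + G`.
-/
theorem G_quartic : (1 + X) * G = X * (1 + X) ^ 2 + X ^ 3 * G ^ 4 := by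
  linear_combination (X * (1 + G) + 1) * G_cubic
    + (X ^ 3 * (2 * (1 + G) ^ 3 - 3 * (1 + G) ^ 2 + 2 * (1 + G) - 1) + G - X - X ^ 2) * two_eq_zero

theorem explicitSeries_quartic : (1 + X) * explicitSeries (ZMod 2) =
    X * (1 + X) ^ 2 + X ^ 3 * explicitSeries (ZMod 2) ^ 4 := by
  have h2 := two_eq_zero
  have hD := X_mul_explicitSeries (ZMod 2)
  have hK := moserSeries_eq (ZMod 2)
  rw [expand_four_eq_pow] at hK
  generalize explicitSeries (ZMod 2) = D at *
  generalize moserSeries (ZMod 2) = K at *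
  apply mul_left_cancel₀ (X_ne_zero (R := ZMod 2))
  have h4 : X ^ 4 * D ^ 4 = (1 + X) ^ 4 * (K - 1) ^ 4 := by rw [← mul_pow, hD, mul_pow]
  linear_combination (1 + X) * hD - h4 + (1 + X) ^ 2 * hK
    + (1 + X) ^ 2 * (-X * (K - 1) ^ 4 - (1 + X ^ 2) * (1 - 2 * K ^ 3 + 3 * K ^ 2 - 2 * K)) * h2

theorem G_eq_explicitSeries : G = explicitSeries (ZMod 2) := by
  have h2 := two_eq_zero
  have h1 := G_quartic
  have h3 := explicitSeries_quartic
  generalize explicitSeries (ZMod 2) = D at *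
  -- Fourth powers are additive here, so the difference of two roots solves the homogeneous
  -- equation; the second factor has constant term 1.
  have h4 : (G - D) * ((1 + X) - X ^ 3 * (G - D) ^ 3) = 0 := by
    have : (G - D) ^ 4 = G ^ 4 - D ^ 4 := by
      linear_combination (-2 * G ^ 3 * D + 3 * G ^ 2 * D ^ 2 - 2 * G * D ^ 3 + D ^ 4) * h2
    linear_combination h1 - h3 - X ^ 3 * this
  rcases mul_eq_zero.1 h4 with h | h
  · exact sub_eq_zero.1 h
  · have := congrArg constantCoeff h
    simp at this

/-! ### Lifting to `ℂ` and conclusion -/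

theorem c_eq_explicitCoeff (n : ℕ) : c n = explicitCoeff n := by
  rw [c, G_eq_explicitSeries, explicitSeries, coeff_mk, ZMod.val_natCast,
    Nat.mod_eq_of_lt (Nat.lt_succ_of_le (explicitCoeff_le_one n))]

theorem X_mul_C : X * C = (1 + X) * (moserSeries ℂ - 1) := by
  rw [← X_mul_explicitSeries]
  congr 1
  ext n
  simp [C, explicitSeries, c_eq_explicitCoeff]

theorem C_functional_equation : C = X * (X + 1)
    + X ^ 3 * (X ^ 4 - 1) * ((X - 1) * (X ^ 4 + 1))⁻¹ * C.subst (X ^ 4 : PowerSeries ℂ) := by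
  rw [← expand_apply (hp := four_ne_zero)]
  have hu : constantCoeff ((X - 1) * (X ^ 4 + 1) : ℂ⟦X⟧) ≠ 0 := by simp
  have hinv := PowerSeries.mul_inv_cancel _ hu
  have hC := X_mul_C
  have hE := congrArg (expand 4 four_ne_zero) hC
  have hK := moserSeries_eq ℂ
  simp only [map_mul, map_add, map_sub, map_one, expand_X] at hE
  have hne : X * ((X - 1) * (X ^ 4 + 1)) ≠ (0 : ℂ⟦X⟧) :=
    mul_ne_zero X_ne_zero fun h => hu (by rw [h, map_zero])
  apply mul_left_cancel₀ hne
  linear_combination (X - 1) * (X ^ 4 + 1) * hC + (X ^ 2 - 1) * (X ^ 4 + 1) * hK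
    - (X ^ 4 - 1) * hE - X ^ 4 * (X ^ 4 - 1) * expand 4 four_ne_zero C * hinv

instance : IsScalarTower (Polynomial ℂ) ℂ⟦X⟧ (LaurentSeries ℂ) :=
  .of_algebraMap_eq fun _ => rfl

theorem transcendental_moserSeries : Transcendental (Polynomial ℂ) (moserSeries ℂ) := by
  refine transcendental_of_eq_mul_expand_four (fun h => ?_) (moserSeries_eq ℂ)
  have := congrArg (PowerSeries.coeff 0) h
  simp [moserSeries, moser_zero] at this

theorem transcendental_C : Transcendental (Polynomial ℂ) C := by
  intro h
  refine transcendental_moserSeries ?_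
  have hX (p : Polynomial ℂ) : IsAlgebraic (Polynomial ℂ) (p : ℂ⟦X⟧) :=
    algebraMap_polynomial_eq_coe p ▸ isAlgebraic_algebraMap p
  have h1 : (1 + Polynomial.X : Polynomial ℂ) ≠ 0 := fun h => by
    simpa using congrArg (Polynomial.eval 0) h
  have h2 : (1 + Polynomial.X : Polynomial ℂ) • moserSeries ℂ =
      (Polynomial.X : Polynomial ℂ) * C + ((1 + Polynomial.X : Polynomial ℂ) : ℂ⟦X⟧) := by
    rw [Algebra.smul_def, algebraMap_polynomial_eq_coe]
    simp only [Polynomial.coe_add, Polynomial.coe_one, Polynomial.coe_X]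
    linear_combination -X_mul_C
  exact IsAlgebraic.of_smul (mem_nonZeroDivisors_of_ne_zero h1)
    (h2 ▸ ((hX _).mul h).add (hX _))

theorem transcendental_C_ratFunc : Transcendental (RatFunc ℂ) (C : LaurentSeries ℂ) := by
  intro h
  rw [← IsFractionRing.isAlgebraic_iff (Polynomial ℂ)] at h
  exact transcendental_C ((isAlgebraic_algebraMap_iff (A := LaurentSeries ℂ)
    HahnSeries.ofPowerSeries_injective).1 h)

end IPTM

theorem mainTheorem5 :
    IPTM.C = X * (X + 1)
        + X ^ 3 * (X ^ 4 - 1) * ((X - 1) * (X ^ 4 + 1))⁻¹ * IPTM.C.subst (X ^ 4 : PowerSeries ℂ) ∧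
      Transcendental (RatFunc ℂ) (IPTM.C : LaurentSeries ℂ) :=
  ⟨IPTM.C_functional_equation, IPTM.transcendental_C_ratFunc⟩
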